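/- Let $\mathbb{D}$ be the open unit disk, $\mathbb{T}$ the unit circle, and let $\Gamma$ be a Fuchsian group, i.e. a discrete subgroup of the group of holomorphic automorphisms of $\mathbb{D}$ (with the topology of locally uniform convergence), which is of convergence type, i.e. $\sum_{\zeta\in\Gamma(0)}(1-|\zeta|)<\infty$, where $\Gamma(0)=\{\gamma(0):\gamma\in\Gamma\}$. Let $m$ be the order of the stabilizer of $0$ in $\Gamma$ (which is finite), let $$B_0(z)=z\prod_{\zeta\in\Gamma(0)\setminus\{0\}}\frac{|\zeta|}{\zeta}\,\frac{\zeta-z}{1-\overline{\zeta}z}$$ be the Blaschke product with simple zeros at the points of $\Gamma(0)$, and let $B_\Gamma=B_0^m$. Let $\hat\Gamma$ be the group of (continuous) homomorphisms $\Gamma\to\mathbb{T}$, written additively. Let $H^2$ be the Hardy space, that is, the subspace of $L^2(\mathbb{T})$ (with respect to normalized Lebesgue measure) of all functions whose Fourier coefficients of negative index vanish, whose elements are regarded as holomorphic functions $f(z)=\sum_{n\ge 0}\hat f(n)z^n$ on $\mathbb{D}$. For $\sigma\in\hat\Gamma$ let $H^2_\sigma=\{f\in H^2: f\circ\gamma=\sigma(\gamma)f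 \text{ for all }\gamma\in\Gamma\}$, let $k_0^\sigma\in H^2_\sigma$ be its kernel function at $0$, i.e. the unique element with $\langle f,k_0^\sigma\rangle=f(0)$ for all $f\in H^2_\sigma$, and let $\kappa_0^\sigma=k_0^\sigma/\|k_0^\sigma\|$ if $k_0^\sigma\neq0$ and $\kappa_0^\sigma=0$ otherwise. There is a unique $\sigma_0\in\hat\Gamma$ with $B_0\circ\gamma=\sigma_0(\gamma)B_0$ for all $\gamma\in\Gamma$. Let $\sigma\in\hat\Gamma$ be such that there is an $f\in H^2_\sigma$ with $f(0)\neq0$, and for $n\ge0$ let $\sigma_n=\sigma-mn\sigma_0$ and $\kappa_0^{(n)}=\kappa_0^{\sigma_n}$. Then the functions $B_\Gamma^n\kappa_0^{(n)}$, $n\geq 0$, that are not zero belong to $H^2_\sigma$ and form an orthonormal basis of $H^2_\sigma$ (functions with different $n$ being different). -/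

import Mathlib

open MeasureTheory Complex Metric
open scoped UnitDisc ComplexConjugate ENNReal

noncomputable section

namespace CharHardy

/-! ### Automorphisms of the disk, Fuchsian groups -/

/-- A self-map of the open unit disk that is holomorphic. -/
def IsHolo (φ : 𝔻 → 𝔻) : Prop :=
  ∃ F : ℂ → ℂ, DifferentiableOn ℂ F (ball 0 1) ∧ ∀ z : 𝔻, F z = φ z

/-- The group of all automorphisms of the disk: the holomorphic bijections of `𝔻` with holomorphic
inverse, under composition. -/
def DiskAut : Subgroup (𝔻 ≃ₜ 𝔻) where
  carrier := {φ | IsHolo φ ∧ IsHolo φ.symm}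
  one_mem' := ⟨⟨id, differentiableOn_id, fun _ => rfl⟩, ⟨id, differentiableOn_id, fun _ => rfl⟩⟩
  inv_mem' := fun h => ⟨h.2, h.1⟩
  mul_mem' := by
    have key : ∀ φ ψ : 𝔻 → 𝔻, IsHolo φ → IsHolo ψ → IsHolo (φ ∘ ψ) := by
      rintro φ ψ ⟨F, hF, hFφ⟩ ⟨G, hG, hGψ⟩
      refine ⟨F ∘ G, hF.comp hG ?_, fun z => ?_⟩
      · intro z hz
        have h := hGψ (UnitDisc.mk z (by simpa using hz))
        simp only [UnitDisc.coe_mk] at h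
        simpa [h] using (ψ (UnitDisc.mk z (by simpa using hz))).norm_lt_one
      · simp [hGψ, hFφ]
    rintro φ ψ ⟨h1, h2⟩ ⟨h3, h4⟩
    exact ⟨key φ ψ h1 h3, key ψ.symm φ.symm h4 h2⟩

/-- Automorphisms act on the disk by evaluation. -/
instance : MulAction DiskAut 𝔻 where
  smul φ z := (φ : 𝔻 ≃ₜ 𝔻) z
  one_smul _ := rfl
  mul_smul _ _ _ := rfl

theorem diskAut_smul_def (φ : DiskAut) (z : 𝔻) : φ • z = (φ : 𝔻 ≃ₜ 𝔻) z := rfl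

/-- The topology of locally uniform convergence on the automorphism group of the disk. -/
instance : TopologicalSpace DiskAut :=
  TopologicalSpace.induced (fun φ => ((φ : 𝔻 ≃ₜ 𝔻) : C(𝔻, 𝔻))) inferInstance

/-- A Fuchsian group is a discrete group of automorphisms of the disk. -/
def IsFuchsian (Γ : Subgroup DiskAut) : Prop := DiscreteTopology Γ

/-- `Γ` is of convergence type: the sum of `1 - |ζ|` over the points `ζ` of the orbit `Γ(0)`
converges. -/
def IsConvergenceType (Γ : Subgroup DiskAut) : Prop :=
  Summable fun ζ : MulAction.orbit Γ (0 : 𝔻) => 1 - ‖((ζ : 𝔻) : ℂ)‖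

/-! ### Blaschke products -/

open Classical in
/-- The simple Blaschke factor with zero `ζ`, which is `z` if `ζ = 0`. -/
def blaschkeFactor (ζ z : 𝔻) : ℂ :=
  if ζ = 0 then (z : ℂ)
  else (‖(ζ : ℂ)‖ : ℂ) / (ζ : ℂ) * (((ζ : ℂ) - z) / (1 - conj (ζ : ℂ) * z))

/-- The Blaschke product `B₀` for the orbit `Γ(0)`, with a simple zero at each point of it. -/
def orbitBlaschke (Γ : Subgroup DiskAut) (z : 𝔻) : ℂ :=
  ∏' ζ : MulAction.orbit Γ (0 : 𝔻), blaschkeFactor ζ z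

/-- The order of the stabilizer of the origin in `Γ`. -/
def stabOrder (Γ : Subgroup DiskAut) : ℕ := Nat.card (MulAction.stabilizer Γ (0 : 𝔻))

/-- The Blaschke product associated to `(Γ, 0)`, that is, `B₀` raised to the order of the
stabilizer of the origin. -/
def groupBlaschke (Γ : Subgroup DiskAut) (z : 𝔻) : ℂ := orbitBlaschke Γ z ^ stabOrder Γ

/-- `χ` is the character associated to `(Γ, 0)`: `B₀ ∘ γ = χ(γ) B₀` for all `γ ∈ Γ`. -/
def IsOrbitCharacter (Γ : Subgroup DiskAut) (χ : Γ →ₜ* Circle) : Prop :=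
  ∀ (γ : Γ) (z : 𝔻), orbitBlaschke Γ (γ • z) = (χ γ : ℂ) * orbitBlaschke Γ z

/-! ### The Hardy space -/

/-- `L²` of the circle with respect to normalized Lebesgue measure; the point `t` of `ℝ / ℤ` stands
for the point `exp (2 π i t)` of the circle. -/
abbrev LTwo : Type := Lp ℂ 2 (AddCircle.haarAddCircle (T := (1 : ℝ)))

/-- The `n`-th Fourier coefficient as a continuous linear functional on `L²`. -/
def fourierCLM (n : ℤ) : LTwo →L[ℂ] ℂ :=
  LinearMap.mkContinuous
    { toFun := fun f => fourierCoeff f n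
      map_add' := fun f g => by simp only [← fourierBasis_repr, map_add]; rfl
      map_smul' := fun c f => by simp only [← fourierBasis_repr, map_smul]; rfl } 1 fun f => by
    have h := lp.norm_apply_le_norm (p := 2) (by norm_num) (fourierBasis.repr f) n
    rw [fourierBasis_repr, LinearIsometryEquiv.norm_map] at h
    simpa using h

theorem fourierCLM_apply (n : ℤ) (f : LTwo) : fourierCLM n f = fourierCoeff f n := rfl

theorem norm_fourierCLM_le (n : ℤ) (f : LTwo) : ‖fourierCLM n f‖ ≤ ‖f‖ := by
  have h := lp.norm_apply_le_norm (p := 2) (by norm_num) (fourierBasis.repr f) n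
  rwa [fourierBasis_repr, LinearIsometryEquiv.norm_map] at h

/-- The Hardy space `H²`: the functions in `L²` of the circle whose Fourier coefficients of negative
index vanish. -/
def HTwo : Submodule ℂ LTwo where
  carrier := {f | ∀ n : ℤ, n < 0 → fourierCoeff f n = 0}
  add_mem' := fun {f g} hf hg n hn => by
    have := (fourierCLM n).map_add f g
    simp only [fourierCLM_apply, hf n hn, hg n hn, add_zero] at this
    exact this
  zero_mem' := fun n _ => (fourierCLM n).map_zero
  smul_mem' := fun c f hf n hn => by
    have := (fourierCLM n).map_smul c f
    simp only [fourierCLM_apply, hf n hn, smul_zero] at this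
    exact this

instance : CompleteSpace HTwo := by
  refine IsClosed.completeSpace_coe (hs := ?_)
  have : (HTwo : Set LTwo) = ⋂ n : ℤ, ⋂ _ : n < 0, {f | fourierCLM n f = 0} := by
    ext f
    simp only [Set.mem_iInter, Set.mem_ofPred_eq, fourierCLM_apply]
    rfl
  rw [this]
  exact isClosed_iInter fun n => isClosed_iInter fun _ =>
    isClosed_eq (fourierCLM n).continuous continuous_const

theorem summable_coeff (f : LTwo) (z : 𝔻) :
    Summable fun n : ℕ => fourierCoeff f n * (z : ℂ) ^ n := by
  refine Summable.of_norm_bounded (g := fun n => ‖f‖ * ‖(z : ℂ)‖ ^ n)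
    ((summable_geometric_of_lt_one (norm_nonneg _) z.norm_lt_one).mul_left _) fun n => ?_
  rw [norm_mul, norm_pow]
  gcongr
  exact norm_fourierCLM_le n f

/-- The value of `f ∈ H²` at the point `z` of the disk, `f(z) = ∑ aₙ zⁿ` with `aₙ` the Fourier
coefficients of `f`, as a continuous linear functional of `f`. -/
def evalCLM (z : 𝔻) : HTwo →L[ℂ] ℂ :=
  LinearMap.mkContinuous
    { toFun := fun f => ∑' n : ℕ, fourierCoeff (f : LTwo) n * (z : ℂ) ^ n
      map_add' := fun f g => by
        rw [← (summable_coeff f z).tsum_add (summable_coeff g z)]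
        refine tsum_congr fun n => ?_
        rw [← add_mul]
        exact congrArg (· * (z : ℂ) ^ n) ((fourierCLM n).map_add (f : LTwo) (g : LTwo))
      map_smul' := fun c f => by
        rw [RingHom.id_apply, smul_eq_mul, ← tsum_mul_left]
        refine tsum_congr fun n => ?_
        rw [← mul_assoc]
        exact congrArg (· * (z : ℂ) ^ n) ((fourierCLM n).map_smul c (f : LTwo)) }
    (1 - ‖(z : ℂ)‖)⁻¹ fun f => by
    refine (tsum_of_norm_bounded
      ((hasSum_geometric_of_lt_one (norm_nonneg _) z.norm_lt_one).mul_left ‖f‖) fun n => ?_).trans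
        (mul_comm _ _).le
    rw [norm_mul, norm_pow]
    gcongr
    exact norm_fourierCLM_le n f

theorem evalCLM_apply (z : 𝔻) (f : HTwo) :
    evalCLM z f = ∑' n : ℕ, fourierCoeff (f : LTwo) n * (z : ℂ) ^ n := rfl

theorem eq_zero_of_evalCLM {f : HTwo} (hf : ∀ z : 𝔻, evalCLM z f = 0) : f = 0 := by
  have hp : HasFPowerSeriesAt (fun _ : ℂ => (0 : ℂ))
      (FormalMultilinearSeries.ofScalars ℂ fun n : ℕ => fourierCoeff (f : LTwo) n) 0 := by
    rw [hasFPowerSeriesAt_iff]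
    filter_upwards [ball_mem_nhds (0 : ℂ) one_pos] with z hz
    have hz : ‖z‖ < 1 := by simpa using hz
    have h := (summable_coeff f (UnitDisc.mk z hz)).hasSum
    rw [← evalCLM_apply, hf] at h
    simpa [mul_comm] using h
  have h0 := hp.eq_zero
  have hc : ∀ n : ℕ, fourierCoeff (f : LTwo) n = 0 := fun n => by
    have h := congrArg (fun p => p.coeff n) h0
    rw [FormalMultilinearSeries.coeff_ofScalars] at h
    exact h
  apply Subtype.ext
  apply fourierBasis.repr.injective
  ext n
  rw [fourierBasis_repr]
  rcases lt_or_ge n 0 with hn | hn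
  · simpa using f.2 n hn
  · lift n to ℕ using hn
    simpa using hc n

/-- `H²` is a reproducing kernel Hilbert space of functions on the disk. -/
instance : RKHS ℂ HTwo 𝔻 ℂ where
  coeCLM := ContinuousLinearMap.pi evalCLM
  coeCLM_injective := by
    rw [injective_iff_map_eq_zero]
    exact fun f hf => eq_zero_of_evalCLM fun z => congrFun hf z

theorem HTwo.coe_apply (f : HTwo) (z : 𝔻) :
    f z = ∑' n : ℕ, fourierCoeff (f : LTwo) n * (z : ℂ) ^ n := rfl

/-- Subspaces of `H²` are reproducing kernel Hilbert spaces of functions on the disk. -/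
instance (M : Submodule ℂ HTwo) : RKHS ℂ M 𝔻 ℂ where
  coeCLM := (ContinuousLinearMap.pi evalCLM).comp M.subtypeL
  coeCLM_injective := by
    rw [injective_iff_map_eq_zero]
    exact fun f hf => Subtype.ext (eq_zero_of_evalCLM fun z => congrFun hf z)

theorem coe_submodule_apply (M : Submodule ℂ HTwo) (f : M) (z : 𝔻) : f z = (f : HTwo) z := rfl

/-- The character automorphic space `H²_σ` of all `f ∈ H²` with `f ∘ γ = σ(γ) f` for all `γ ∈ Γ`. -/
def HSigma (Γ : Subgroup DiskAut) (σ : Γ →ₜ* Circle) : Submodule ℂ HTwo where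
  carrier := {f | ∀ (γ : Γ) (z : 𝔻), f (γ • z) = (σ γ : ℂ) * f z}
  add_mem' := fun {f g} hf hg γ z => by simp [hf γ z, hg γ z, mul_add]
  zero_mem' := fun γ z => by simp
  smul_mem' := fun c f hf γ z => by simp [hf γ z, mul_left_comm]

instance (Γ : Subgroup DiskAut) (σ : Γ →ₜ* Circle) : CompleteSpace (HSigma Γ σ) := by
  refine IsClosed.completeSpace_coe (hs := ?_)
  have : (HSigma Γ σ : Set HTwo) =
      ⋂ γ : Γ, ⋂ z : 𝔻, {f | f (γ • z) = (σ γ : ℂ) * f z} := by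
    ext f
    simp [HSigma]
  rw [this]
  exact isClosed_iInter fun γ => isClosed_iInter fun z =>
    isClosed_eq (RKHS.continuous_eval _) (continuous_const.mul (RKHS.continuous_eval _))

/-! ### Kernel functions -/

/-- The kernel function `k_w` of a subspace of `H²`, characterized by `⟨f, k_w⟩ = f(w)` for all `f`
in the subspace. -/
def kernelFun (M : Submodule ℂ HTwo) [CompleteSpace M] (w : 𝔻) : M := RKHS.kerFun M w 1

/-- The normalized kernel function `κ_w = K(w,w)^(-1/2) k_w`, where `K(w,w) = ‖k_w‖ ^ 2`; it is `0`
if `k_w = 0`. -/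
def normKernelFun (M : Submodule ℂ HTwo) [CompleteSpace M] (w : 𝔻) : M :=
  ((‖kernelFun M w‖⁻¹ : ℝ) : ℂ) • kernelFun M w

/-- The function `B_Γⁿ κ₀⁽ⁿ⁾` on the disk, where `κ₀⁽ⁿ⁾` is the normalized kernel function at `0` of
the space `H²` of the character `σ - m n σ₀`, the group of characters being written
multiplicatively here. -/
def basisFun (Γ : Subgroup DiskAut) (σ σ₀ : Γ →ₜ* Circle) (n : ℕ) (z : 𝔻) : ℂ :=
  groupBlaschke Γ z ^ n * normKernelFun (HSigma Γ (σ / σ₀ ^ (stabOrder Γ * n))) 0 z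

end CharHardy

end

open CharHardy

open MeasureTheory Complex Metric Filter Topology
open scoped UnitDisc ComplexConjugate ENNReal InnerProductSpace

noncomputable section

namespace CharHardy

/-! ### Isometric multiplication operators on reproducing kernel Hilbert spaces -/

section Shift

variable {H : Type*} [NormedAddCommGroup H] [InnerProductSpace ℂ H]

/-! The argument is of Wold type. Multiplication by B_Γ is an isometry of H² that carries
H²_{σ_{n+1}} onto the functions of H²_{σ_n} vanishing at 0, that is, onto the orthogonal complement
of κ_0^{(n)}. Splitting off one kernel function after another gives the orthonormal family
(`exists_hilbertBasis_of_wandering`). Nothing is left over: since |B_Γ(z)| ≤ |z|, no nonzero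
function is divisible by all powers of B_Γ (`eq_zero_of_forall_exists_pow`).

The crux is surjectivity. A function of H²_τ vanishing at 0 vanishes on the whole orbit, hence is
divisible by B_0, with quotient in H²_{τ-σ_0}. The stabilizer of 0 is a cyclic group of m rotations,
on which σ_0 is the rotation factor. A function in H²_σ with f(0) ≠ 0 forces σ, and so every σ_n, to
be trivial there. For 0 < j < m the character σ_n - jσ_0 is then nontrivial on the stabilizer, so
the quotient by B_0^j vanishes at 0 again, and m divisions are possible
(`exists_mem_HSigma_of_apply_zero_of_stabilizer`).

No boundary values are needed. The identity ‖af - Sf‖ = ‖f - āSf‖ for the shift S makes (a - S)(1 -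
āS)⁻¹ isometric; infinite products are weak limits of finite ones (`exists_linearIsometry_tprod`).
The character σ_0 exists because |B_0| is Γ-invariant, by Schwarz–Pick. -/

theorem norm_smul_sub_isometry (S : H →ₗᵢ[ℂ] H) (a : ℂ) (f : H) :
    ‖a • f - S f‖ = ‖f - conj a • S f‖ := by
  rw [← sq_eq_sq₀ (norm_nonneg _) (norm_nonneg _), norm_sub_sq (𝕜 := ℂ), norm_sub_sq (𝕜 := ℂ),
    inner_smul_left, inner_smul_right, norm_smul, norm_smul, S.norm_map, RCLike.norm_conj]
  ring

theorem isUnit_one_sub_smul_isometry [CompleteSpace H] (S : H →ₗᵢ[ℂ] H) {a : ℂ} (ha : ‖a‖ < 1) :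
    IsUnit (1 - a • S.toContinuousLinearMap : H →L[ℂ] H) := by
  refine isUnit_one_sub_of_norm_lt_one ?_
  rw [norm_smul]
  exact mul_lt_one_of_nonneg_of_lt_one_left (norm_nonneg _) ha S.norm_toContinuousLinearMap_le

theorem one_sub_conj_mul_ne_zero (a z : 𝔻) : 1 - conj (a : ℂ) * z ≠ 0 := by
  intro h
  have h1 : ‖conj (a : ℂ) * z‖ = 1 := by rw [← sub_eq_zero.1 h, norm_one]
  rw [norm_mul, RCLike.norm_conj] at h1
  have := mul_lt_one_of_nonneg_of_lt_one_left (norm_nonneg _) a.norm_lt_one z.norm_lt_one.le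
  linarith

variable [CompleteSpace H] [RKHS ℂ H 𝔻 ℂ]

/-- If multiplication by the coordinate function is isometric, so is multiplication by the
disk automorphism that exchanges `0` and `a`. -/
theorem exists_linearIsometry_mobius {S : H →ₗᵢ[ℂ] H} (hS : ∀ (f : H) (z : 𝔻), S f z = z * f z)
    (a : 𝔻) : ∃ T : H →ₗᵢ[ℂ] H,
    (∀ (f : H) (z : 𝔻), T f z = ((a : ℂ) - z) / (1 - conj (a : ℂ) * z) * f z) ∧
    ∀ f, ∃ g, T g = (a : ℂ) • f - S f := by
  obtain ⟨u, hu⟩ := isUnit_one_sub_smul_isometry S (a := conj (a : ℂ))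
    (by rw [RCLike.norm_conj]; exact a.norm_lt_one)
  have hu' : ∀ f, u.1 f = f - conj (a : ℂ) • S f := fun f => by rw [hu]; rfl
  have hinv : ∀ f, u.1 (u⁻¹.1 f) = f := fun f => by
    rw [← mul_apply_eq_comp, u.mul_inv]; rfl
  have hinv' : ∀ f, u⁻¹.1 (u.1 f) = f := fun f => by
    rw [← mul_apply_eq_comp, u.inv_mul]; rfl
  -- T = (a - S)(1 - āS)⁻¹, the Möbius map applied to S; the inverse exists by a Neumann series.
  let T : H →ₗ[ℂ] H :=
    ((a : ℂ) • LinearMap.id - S.toLinearMap) ∘ₗ (u⁻¹.1 : H →L[ℂ] H).toLinearMap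
  have hT : ∀ f, T f = (a : ℂ) • u⁻¹.1 f - S (u⁻¹.1 f) := fun f => rfl
  refine ⟨⟨T, fun f => ?_⟩, fun f z => ?_, fun f => ⟨u.1 f, ?_⟩⟩
  · rw [hT, norm_smul_sub_isometry, ← hu', hinv]
  · change T f z = _
    have h : f z = (1 - conj (a : ℂ) * z) * (u⁻¹.1 f) z := by
      conv_lhs => rw [← hinv f, hu']
      simp [hS]
      ring
    rw [hT, h, ← mul_assoc, div_mul_cancel₀ _ (one_sub_conj_mul_ne_zero a z)]
    simp [hS]
    ring
  · change T _ = _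
    rw [hT, hinv']

theorem exists_unit_blaschkeFactor (a : 𝔻) : ∃ c : ℂ, ‖c‖ = 1 ∧
    ∀ z, blaschkeFactor a z = c * (((a : ℂ) - z) / (1 - conj (a : ℂ) * z)) := by
  by_cases ha : a = 0
  · exact ⟨-1, by simp, fun z => by simp [blaschkeFactor, ha]⟩
  · refine ⟨(‖(a : ℂ)‖ : ℂ) / a, ?_, fun z => by simp [blaschkeFactor, ha]⟩
    have : ‖(a : ℂ)‖ ≠ 0 := by simpa using ha
    rw [norm_div, norm_real, norm_norm, div_self this]

/-- Multiplication by a Blaschke factor is isometric, and its range consists of the functions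
that vanish at the zero of the factor. -/
theorem exists_linearIsometry_blaschkeFactor {S : H →ₗᵢ[ℂ] H}
    (hS : ∀ (f : H) (z : 𝔻), S f z = z * f z) {a : 𝔻}
    (ha : ∀ g : H, (∀ h, ⟪g, (a : ℂ) • h - S h⟫_ℂ = 0) → ∀ f : H, f a = 0 → ⟪g, f⟫_ℂ = 0) :
    ∃ T : H →ₗᵢ[ℂ] H,
    (∀ (f : H) (z : 𝔻), T f z = blaschkeFactor a z * f z) ∧
      ∀ f : H, f a = 0 → ∃ g, T g = f := by
  obtain ⟨T, hT, hTr⟩ := exists_linearIsometry_mobius hS a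
  obtain ⟨c, hc, hb⟩ := exists_unit_blaschkeFactor a
  have hc0 : c ≠ 0 := by rintro rfl; simp at hc
  refine ⟨⟨c • T.toLinearMap, fun f => ?_⟩, fun f z => ?_, fun f hf => ?_⟩
  · change ‖c • T f‖ = _
    rw [norm_smul, hc, one_mul, T.norm_map]
  · change (c • T f) z = _
    rw [RKHS.coe_smul, Pi.smul_apply, hT, hb, smul_eq_mul, mul_assoc]
  -- An isometry has closed range, so it suffices that f is orthogonal to everything orthogonal to
  -- the range; this is what `ha` provides.
  · have hcl : IsClosed (LinearMap.range T.toLinearMap : Set H) := by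
      have h := T.isometry.isClosedEmbedding.isClosed_range
      rwa [← T.coe_toLinearMap, ← LinearMap.coe_range] at h
    have hmem : f ∈ (LinearMap.range T.toLinearMap)ᗮᗮ := by
      rw [Submodule.mem_orthogonal]
      intro g hg
      refine ha g (fun h => ?_) f hf
      obtain ⟨k, hk⟩ := hTr h
      rw [← hk]
      exact (Submodule.mem_orthogonal' _ _).1 hg _ ⟨k, rfl⟩
    rw [Submodule.orthogonal_orthogonal_eq_closure, hcl.submodule_topologicalClosure_eq] at hmem
    obtain ⟨g, hg⟩ := hmem
    refine ⟨c⁻¹ • g, ?_⟩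
    change c • T (c⁻¹ • g) = f
    rw [map_smul, smul_inv_smul₀ hc0]
    exact hg

end Shift

/-! ### Finite and infinite products of isometric multipliers -/

section Products

variable {X H : Type*} [NormedAddCommGroup H] [InnerProductSpace ℂ H] [RKHS ℂ H X ℂ]

/-- Bounded families in a reproducing kernel Hilbert space converge pointwise along ultrafilters to
an element of the space. -/
theorem exists_tendsto_eval_of_norm_le [CompleteSpace H] {ι : Type*} (l : Ultrafilter ι) (F : ι → H) {C : ℝ}
    (hF : ∀ i, ‖F i‖ ≤ C) :
    ∃ g : H, ‖g‖ ≤ C ∧ ∀ x, Tendsto (fun i => F i x) l (𝓝 (g x)) := by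
  let D := InnerProductSpace.toDual ℂ H
  have hK := WeakDual.isCompact_closedBall (𝕜 := ℂ) (E := H) 0 C
  let G : ι → WeakDual ℂ H := fun i => StrongDual.toWeakDual (D (F i))
  have hG : ∀ i, G i ∈ WeakDual.toStrongDual ⁻¹' closedBall (0 : StrongDual ℂ H) C := fun i => by
    simpa [G] using (D.norm_map (F i)).le.trans (hF i)
  -- Banach–Alaoglu; evaluation at a point is pairing with a kernel function, hence weak-*
  -- continuous. The conjugations below arise because `toDual` puts `F i` in the conjugate-linear
  -- slot.
  obtain ⟨φ, hφ, hlim⟩ := hK.ultrafilter_le_nhds (l.map G)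
    (le_principal_iff.2 (mem_map.2 (Eventually.of_forall hG)))
  refine ⟨D.symm (WeakDual.toStrongDual φ), ?_, fun x => ?_⟩
  · rw [LinearIsometryEquiv.norm_map]
    simpa using hφ
  · have hc : Tendsto (fun ψ : WeakDual ℂ H => ψ (RKHS.kerFun H x 1)) (𝓝 φ)
        (𝓝 (φ (RKHS.kerFun H x 1))) :=
      (WeakDual.eval_continuous _).tendsto φ
    have h1 : Tendsto (fun i => conj (G i (RKHS.kerFun H x 1))) l
        (𝓝 (conj (φ (RKHS.kerFun H x 1)))) :=
      (continuous_conj.tendsto _).comp (hc.comp hlim)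
    have h2 : ∀ i, conj (G i (RKHS.kerFun H x 1)) = F i x := fun i => by
      change conj (⟪F i, RKHS.kerFun H x 1⟫_ℂ) = _
      simp
    have h3 : conj (φ (RKHS.kerFun H x 1)) = D.symm (WeakDual.toStrongDual φ) x := by
      have : φ (RKHS.kerFun H x 1) =
          ⟪D.symm (WeakDual.toStrongDual φ), RKHS.kerFun H x 1⟫_ℂ := by
        rw [InnerProductSpace.toDual_symm_apply]; rfl
      rw [this]
      simp
    rw [← h3]
    simpa only [h2] using h1

variable {ι : Type*} {b : ι → X → ℂ} {p : ι → X}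

/-- Zeros are divided out one at a time: since the other factors do not vanish at `p j`, the
quotient still does. -/
theorem exists_linearIsometry_prod
    (hb : ∀ i, ∃ T : H →ₗᵢ[ℂ] H, (∀ (f : H) x, T f x = b i x * f x) ∧
      ∀ f : H, f (p i) = 0 → ∃ g, T g = f)
    (hbp : ∀ i j, i ≠ j → b i (p j) ≠ 0) (s : Finset ι) :
    ∃ T : H →ₗᵢ[ℂ] H, (∀ (f : H) x, T f x = (∏ i ∈ s, b i x) * f x) ∧
      ∀ f : H, (∀ i ∈ s, f (p i) = 0) → ∃ g, T g = f := by
  classical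
  induction s using Finset.induction_on with
  | empty => exact ⟨LinearIsometry.id, fun f x => by simp, fun f _ => ⟨f, rfl⟩⟩
  | insert j s hj ih =>
    obtain ⟨T, hT, hTr⟩ := ih
    obtain ⟨U, hU, hUr⟩ := hb j
    refine ⟨T.comp U, fun f x => ?_, fun f hf => ?_⟩
    · change T (U f) x = _
      rw [hT, hU, Finset.prod_insert hj]
      ring
    · obtain ⟨g, hg⟩ := hTr f fun i hi => hf i (Finset.mem_insert_of_mem hi)
      obtain ⟨k, hk⟩ := hUr g (by
        have h := hf j (Finset.mem_insert_self _ _)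
        rw [← hg, hT] at h
        refine (mul_eq_zero.1 h).resolve_left (Finset.prod_ne_zero_iff.2 fun i hi => hbp i j ?_)
        rintro rfl
        exact hj hi)
      exact ⟨k, (congrArg T hk).trans hg⟩

/-- Multiplication by an infinite product of isometric multipliers is isometric, and a function that
vanishes at the zeros of all factors is divisible by the product. -/
theorem exists_linearIsometry_tprod [CompleteSpace H]
    (hb : ∀ i, ∃ T : H →ₗᵢ[ℂ] H, (∀ (f : H) x, T f x = b i x * f x) ∧
      ∀ f : H, f (p i) = 0 → ∃ g, T g = f)
    (hbp : ∀ i j, b i (p j) = 0 ↔ i = j) {B : X → ℂ}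
    (hB : ∀ x, HasProd (fun i => b i x) (B x))
    (hB0 : ∀ f : H, (∀ x, B x * f x = 0) → f = 0) :
    ∃ T : H →ₗᵢ[ℂ] H, (∀ (f : H) x, T f x = B x * f x) ∧
      ∀ f : H, (∀ i, f (p i) = 0) → ∃ g, T g = f := by
  have hprod := exists_linearIsometry_prod hb fun i j hij h => hij ((hbp i j).1 h)
  let l : Ultrafilter (Finset ι) := Ultrafilter.of atTop
  have hBl : ∀ x, Tendsto (fun s => ∏ i ∈ s, b i x) l (𝓝 (B x)) := fun x =>
    Tendsto.mono_left (by simpa [HasProd] using hB x) (Ultrafilter.of_le atTop)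
  have hBp : ∀ j, B (p j) = 0 := fun j =>
    (hB (p j)).unique (hasProd_zero_of_exists_eq_zero ⟨j, (hbp j j).2 rfl⟩)
  -- The quotients by finite subproducts all have norm ‖f‖, so they have a limit g, and B g = f
  -- pointwise.
  have hdiv : ∀ f : H, (∀ i, f (p i) = 0) → ∃ g : H, ‖g‖ ≤ ‖f‖ ∧ ∀ x, B x * g x = f x := by
    intro f hf
    choose T hT hTr using hprod
    choose G hG using fun s => hTr s f fun i _ => hf i
    obtain ⟨g, hg, hlim⟩ := exists_tendsto_eval_of_norm_le l G
      (fun s => by rw [← hG s, (T s).norm_map] : ∀ s, ‖G s‖ ≤ ‖f‖)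
    refine ⟨g, hg, fun x => tendsto_nhds_unique ((hBl x).mul (hlim x)) ?_⟩
    have : (fun s => (∏ i ∈ s, b i x) * G s x) = fun _ => f x :=
      funext fun s => by rw [← hT s, hG]
    rw [this]
    exact tendsto_const_nhds
  have hmul : ∀ f : H, ∃ h : H, ‖h‖ ≤ ‖f‖ ∧ ∀ x, h x = B x * f x := by
    intro f
    choose T hT _ using hprod
    obtain ⟨h, hh, hlim⟩ := exists_tendsto_eval_of_norm_le l (fun s => T s f)
      (fun s => ((T s).norm_map f).le)
    refine ⟨h, hh, fun x => tendsto_nhds_unique (hlim x) ?_⟩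
    simpa only [hT] using (hBl x).mul_const (f x)
  choose T hTn hT using hmul
  have hinj : ∀ f g : H, (∀ x, B x * f x = B x * g x) → f = g := fun f g h =>
    sub_eq_zero.1 (hB0 _ fun x => by simp [mul_sub, h])
  refine ⟨{ toFun := T, map_add' := fun f g => ?_, map_smul' := fun c f => ?_,
            norm_map' := fun f => le_antisymm (hTn f) ?_ }, hT, fun f hf => ?_⟩
  · exact RKHS.ext fun x => by simp [hT, mul_add]
  · exact RKHS.ext fun x => by simp [hT, mul_left_comm]
  -- The reverse inequality: B f vanishes at all zeros, so it has a quotient of norm at most ‖T f‖,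
  -- and this quotient can only be f.
  · obtain ⟨g, hg, hBg⟩ := hdiv (T f) fun i => by rw [hT, hBp, zero_mul]
    rwa [hinj g f fun x => by rw [hBg, hT]] at hg
  · obtain ⟨g, -, hBg⟩ := hdiv f hf
    exact ⟨g, RKHS.ext fun x => (hT g x).trans (hBg x)⟩

end Products

/-! ### Wandering vectors and Hilbert bases -/

section Wandering

variable {H : Type*} [NormedAddCommGroup H] [InnerProductSpace ℂ H]

/-- A wandering subspace decomposition: if the elements of `M n` that are orthogonal to a vector
`κ n` of `M n`, which is zero or a unit vector, form the space `T (M (n + 1))`, with `T` an isometry,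
then the nonzero vectors `T ^ n (κ n)` form a Hilbert basis of `M 0`, provided that no nonzero vector
is in the range of all powers of `T`. -/
theorem exists_hilbertBasis_of_wandering (T : H →ₗᵢ[ℂ] H) (M : ℕ → Submodule ℂ H)
    {M₀ : Submodule ℂ H} [CompleteSpace M₀] (hM₀ : M 0 = M₀) (κ : ℕ → H) (hκM : ∀ n, κ n ∈ M n) (hκ : ∀ n, κ n = 0 ∨ ‖κ n‖ = 1)
    (hTM : ∀ n, ∀ f ∈ M (n + 1), T f ∈ M n)
    (hκT : ∀ n, ∀ f ∈ M (n + 1), ⟪κ n, T f⟫_ℂ = 0)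
    (hdiv : ∀ n, ∀ f ∈ M n, ⟪κ n, f⟫_ℂ = 0 → ∃ g ∈ M (n + 1), T g = f)
    (hT : ∀ f, (∀ n, ∃ g, (T ^ n) g = f) → f = 0)
    {p : ℕ → Prop} (hp : ∀ n, p n ↔ (T ^ n) (κ n) ≠ 0) :
    ∃ b : HilbertBasis {n : ℕ // p n} ℂ M₀, ∀ n, (b n : H) = (T ^ n.1) (κ n) := by
  subst hM₀
  -- A free `p` lets the index type be stated later through functions on the disk rather than
  -- vectors of H.
  obtain rfl : p = fun n => (T ^ n) (κ n) ≠ 0 := funext fun n => propext (hp n)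
  have hTn : ∀ n k, ∀ f ∈ M (k + n), (T ^ n) f ∈ M k := by
    intro n
    induction n with
    | zero => exact fun k f hf => hf
    | succ n ih =>
      intro k f hf
      rw [pow_succ]
      exact ih k (T f) (hTM _ f hf)
  have hv : ∀ n, (T ^ n) (κ n) ∈ M 0 := fun n => hTn n 0 _ (by simpa using hκM n)
  let v : {n : ℕ // (T ^ n) (κ n) ≠ 0} → M 0 := fun n => ⟨(T ^ n.1) (κ n), hv n⟩
  have hlt : ∀ n m, n < m → ⟪(T ^ n) (κ n), (T ^ m) (κ m)⟫_ℂ = 0 := by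
    intro n m hnm
    obtain ⟨k, rfl⟩ := Nat.exists_eq_add_of_lt hnm
    have h : (T ^ (n + k + 1)) (κ (n + k + 1)) = (T ^ n) (T ((T ^ k) (κ (n + k + 1)))) := by
      rw [add_assoc, pow_add, add_comm k, pow_add, pow_one]
      rfl
    rw [h, LinearIsometry.inner_map_map]
    exact hκT n _ (hTn k _ _ (by convert hκM _ using 2; ring))
  have hon : Orthonormal ℂ v := by
    constructor
    · intro n
      change ‖(T ^ n.1) (κ n)‖ = 1
      rw [LinearIsometry.norm_map]
      refine (hκ n).resolve_left fun h => n.2 ?_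
      rw [h, map_zero]
    · intro n m hnm
      change ⟪(T ^ n.1) (κ n), (T ^ m.1) (κ m)⟫_ℂ = 0
      rcases lt_or_gt_of_ne (Subtype.coe_ne_coe.2 hnm) with h | h
      · exact hlt _ _ h
      · exact inner_eq_zero_symm.1 (hlt _ _ h)
  have hperp : (Submodule.span ℂ (Set.range v))ᗮ = ⊥ := by
    rw [Submodule.eq_bot_iff]
    intro f hf
    have hvf : ∀ n, ⟪(T ^ n) (κ n), (f : H)⟫_ℂ = 0 := by
      intro n
      by_cases hn : (T ^ n) (κ n) = 0
      · rw [hn, inner_zero_left]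
      · exact (Submodule.mem_orthogonal _ _).1 hf (v ⟨n, hn⟩)
          (Submodule.subset_span (Set.mem_range_self _))
    -- Orthogonality of f = Tⁿ g to Tⁿ (κ n) means orthogonality of g to κ n, so one more T can be
    -- divided out.
    have hdec : ∀ n, ∃ g ∈ M n, (T ^ n) g = f := by
      intro n
      induction n with
      | zero => exact ⟨f, f.2, rfl⟩
      | succ n ih =>
        obtain ⟨g, hg, hgf⟩ := ih
        obtain ⟨k, hk, hkg⟩ := hdiv n g hg (by
          have h := hvf n
          rwa [← hgf, LinearIsometry.inner_map_map] at h)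
        refine ⟨k, hk, ?_⟩
        rw [pow_succ, ← hgf, ← hkg]
        rfl
    exact Subtype.ext (hT f fun n => (hdec n).imp fun g hg => hg.2)
  refine ⟨HilbertBasis.mkOfOrthogonalEqBot hon hperp, fun n => ?_⟩
  rw [HilbertBasis.coe_mkOfOrthogonalEqBot]

end Wandering

/-! ### The unilateral shift on the Hardy space -/

theorem inner_fourierBasis (n : ℤ) (f : LTwo) : ⟪fourierBasis n, f⟫_ℂ = fourierCoeff f n := by
  rw [← fourierBasis_repr, fourierBasis.repr_apply_apply]

/-- The Hilbert basis of `L²` obtained from the Fourier basis by raising all indices by one. -/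
def shiftedFourierBasis : HilbertBasis ℤ ℂ LTwo :=
  HilbertBasis.mk (v := fun n : ℤ => fourierBasis (n + 1))
    (fourierBasis.orthonormal.comp _ (add_left_injective (1 : ℤ))) (by
      have h : Set.range (fun n : ℤ => (fourierBasis (n + 1) : LTwo)) =
          Set.range (fourierBasis : ℤ → LTwo) :=
        (Equiv.addRight (1 : ℤ)).surjective.range_comp (fourierBasis : ℤ → LTwo)
      rw [h]
      exact fourierBasis.dense_span.ge)

/-- The bilateral shift on `L²`. -/
def bilateralShift : LTwo ≃ₗᵢ[ℂ] LTwo := fourierBasis.repr.trans shiftedFourierBasis.repr.symm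

theorem bilateralShift_fourierBasis (n : ℤ) :
    bilateralShift (fourierBasis n) = fourierBasis (n + 1) := by
  classical
  rw [bilateralShift, LinearIsometryEquiv.trans_apply, HilbertBasis.repr_self,
    HilbertBasis.repr_symm_single, shiftedFourierBasis, HilbertBasis.coe_mk]

theorem fourierCoeff_bilateralShift (f : LTwo) (n : ℤ) :
    fourierCoeff (bilateralShift f) (n + 1) = fourierCoeff f n := by
  rw [← inner_fourierBasis, ← bilateralShift_fourierBasis, LinearIsometryEquiv.inner_map_map,
    inner_fourierBasis]

/-- The unilateral shift on `H²`, that is, multiplication by the coordinate function. -/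
def shift : HTwo →ₗᵢ[ℂ] HTwo where
  toLinearMap := bilateralShift.toLinearEquiv.toLinearMap.restrict fun f hf n hn => by
    have h := fourierCoeff_bilateralShift f (n - 1)
    rw [sub_add_cancel] at h
    exact h.trans (hf _ (by omega))
  norm_map' := fun f => bilateralShift.norm_map f

theorem fourierCoeff_shift_succ (f : HTwo) (n : ℤ) :
    fourierCoeff (shift f : LTwo) (n + 1) = fourierCoeff (f : LTwo) n :=
  fourierCoeff_bilateralShift f n

theorem fourierCoeff_shift_zero (f : HTwo) : fourierCoeff (shift f : LTwo) 0 = 0 := by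
  have h := fourierCoeff_shift_succ f (-1)
  rw [neg_add_cancel] at h
  exact h.trans (f.2 _ (by norm_num))

theorem shift_apply (f : HTwo) (z : 𝔻) : shift f z = z * f z := by
  rw [HTwo.coe_apply, HTwo.coe_apply, (summable_coeff _ z).tsum_eq_zero_add, ← tsum_mul_left]
  simp only [Nat.cast_zero, fourierCoeff_shift_zero, zero_mul, zero_add, Nat.cast_succ,
    fourierCoeff_shift_succ]
  exact tsum_congr fun n => by ring

/-- The monomial `zⁿ` as an element of `H²`. -/
def monomial (n : ℕ) : HTwo := ⟨fourierBasis (n : ℤ), fun k hk => by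
  rw [← inner_fourierBasis]
  exact fourierBasis.orthonormal.2 (by omega)⟩

theorem inner_monomial (n : ℕ) (f : HTwo) :
    ⟪monomial n, f⟫_ℂ = fourierCoeff (f : LTwo) n := inner_fourierBasis n f

theorem shift_monomial (n : ℕ) : shift (monomial n) = monomial (n + 1) :=
  Subtype.ext (bilateralShift_fourierBasis n)

theorem hasSum_inner (f g : HTwo) :
    HasSum (fun n : ℕ => conj (fourierCoeff (f : LTwo) n) * fourierCoeff (g : LTwo) n)
      ⟪f, g⟫_ℂ := by
  have h := fourierBasis.hasSum_inner_mul_inner (f : LTwo) (g : LTwo)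
  rw [← Function.Injective.hasSum_iff (Nat.cast_injective (R := ℤ))] at h
  · refine (congrArg (HasSum · ⟪(f : LTwo), (g : LTwo)⟫_ℂ) (funext fun n => ?_)).mp h
    rw [Function.comp_apply, inner_fourierBasis, ← inner_conj_symm, inner_fourierBasis]
  · intro n hn
    rw [inner_fourierBasis, g.2 n, mul_zero]
    by_contra hn'
    exact hn ⟨n.toNat, by simpa using hn'⟩

theorem monomial_zero_apply (z : 𝔻) : monomial 0 z = 1 := by
  rw [HTwo.coe_apply, tsum_eq_single 0]
  · rw [pow_zero, mul_one, ← inner_monomial, inner_self_eq_norm_sq_to_K (𝕜 := ℂ) (E := HTwo)]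
    have : ‖monomial 0‖ = 1 := fourierBasis.orthonormal.1 0
    simp [this]
  · intro n hn
    rw [← inner_monomial]
    have : ⟪monomial n, monomial 0⟫_ℂ = 0 := fourierBasis.orthonormal.2 (by simpa using hn)
    rw [this, zero_mul]

/-- Orthogonality to the range of a - S forces the conjugated coefficients of g to be geometric with
ratio a, so g is a multiple of the Szegő kernel at a. -/
theorem inner_eq_of_orthogonal_range {a : 𝔻} {g : HTwo}
    (hg : ∀ h, ⟪g, (a : ℂ) • h - shift h⟫_ℂ = 0) (f : HTwo) :
    ⟪g, f⟫_ℂ = conj (fourierCoeff (g : LTwo) 0) * f a := by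
  have hg' : ∀ h : HTwo, (a : ℂ) * ⟪g, h⟫_ℂ = ⟪g, shift h⟫_ℂ := fun h => by
    rw [← sub_eq_zero, ← inner_smul_right (𝕜 := ℂ) (E := HTwo),
      ← inner_sub_right (𝕜 := ℂ) (E := HTwo)]
    exact hg h
  have hinner : ∀ n, ⟪g, monomial n⟫_ℂ = conj (fourierCoeff (g : LTwo) n) := fun n => by
    rw [← inner_monomial, inner_conj_symm (𝕜 := ℂ) (E := HTwo)]
  have hc : ∀ n : ℕ, conj (fourierCoeff (g : LTwo) n) =
      conj (fourierCoeff (g : LTwo) 0) * (a : ℂ) ^ n := by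
    intro n
    induction n with
    | zero => simp
    | succ n ih =>
      have h := hg' (monomial n)
      rw [shift_monomial, hinner, hinner, ih] at h
      rw [← h]
      ring
  rw [← (hasSum_inner g f).tsum_eq, HTwo.coe_apply, ← tsum_mul_left]
  refine tsum_congr fun n => ?_
  rw [hc]
  ring

/-- Multiplication by a Blaschke factor is isometric on `H²`, and its range consists of the functions
that vanish at the zero of the factor. -/
theorem HTwo.exists_linearIsometry_blaschkeFactor (a : 𝔻) : ∃ T : HTwo →ₗᵢ[ℂ] HTwo,
    (∀ (f : HTwo) (z : 𝔻), T f z = blaschkeFactor a z * f z) ∧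
      ∀ f : HTwo, f a = 0 → ∃ g, T g = f :=
  CharHardy.exists_linearIsometry_blaschkeFactor (H := HTwo) shift_apply fun g hg f hf => by
    rw [inner_eq_of_orthogonal_range hg, hf, mul_zero]

/-! ### Holomorphic functions on the disk -/

/-- A function on the disk that is holomorphic. -/
def IsHoloFun (f : 𝔻 → ℂ) : Prop :=
  ∃ F : ℂ → ℂ, DifferentiableOn ℂ F (ball 0 1) ∧ ∀ z : 𝔻, F z = f z

theorem IsHoloFun.continuous {f : 𝔻 → ℂ} (hf : IsHoloFun f) : Continuous f := by
  obtain ⟨F, hF, hFf⟩ := hf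
  have h : f = fun z : 𝔻 => F z := funext fun z => (hFf z).symm
  rw [h]
  exact hF.continuousOn.comp_continuous UnitDisc.continuous_coe fun z => by
    simpa using z.norm_lt_one

theorem IsHoloFun.comp {f : 𝔻 → ℂ} {φ : 𝔻 → 𝔻} (hf : IsHoloFun f) (hφ : IsHolo φ) :
    IsHoloFun (f ∘ φ) := by
  obtain ⟨F, hF, hFf⟩ := hf
  obtain ⟨G, hG, hGφ⟩ := hφ
  refine ⟨F ∘ G, hF.comp hG fun z hz => ?_, fun z => ?_⟩
  · lift z to 𝔻 using by simpa using hz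
    rw [hGφ]
    simpa using (φ z).norm_lt_one
  · rw [Function.comp_apply, hGφ, hFf, Function.comp_apply]

/-- Two holomorphic functions with the same modulus differ by a unimodular constant. -/
theorem IsHoloFun.exists_unit_mul {f g : 𝔻 → ℂ} (hf : IsHoloFun f) (hg : IsHoloFun g)
    (hfg : ∀ z, ‖f z‖ = ‖g z‖) {w : 𝔻} (hw : g w ≠ 0) :
    ∃ c : Circle, ∀ z, f z = c * g z := by
  obtain ⟨F, hF, hFf⟩ := hf
  obtain ⟨G, hG, hGg⟩ := hg
  have hwb : (w : ℂ) ∈ ball (0 : ℂ) 1 := by simpa using w.norm_lt_one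
  have hnhds := isOpen_ball.mem_nhds hwb
  have hGw : G w ≠ 0 := by rwa [hGg]
  have hGne : ∀ᶠ z in 𝓝 (w : ℂ), G z ≠ 0 :=
    (hG.continuousOn.continuousAt hnhds).eventually_ne hGw
  have hnorm : ∀ z ∈ ball (0 : ℂ) 1, ‖F z‖ = ‖G z‖ := fun z hz => by
    lift z to 𝔻 using by simpa using hz
    rw [hFf, hGg, hfg]
  have hone : ∀ᶠ z in 𝓝 (w : ℂ), ‖F z / G z‖ = 1 := by
    filter_upwards [hGne, hnhds] with z hz hzb
    rw [norm_div, hnorm z hzb, div_self (norm_ne_zero_iff.2 hz)]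
  -- F / G has modulus 1 near w, so the maximum principle makes it constant there; the identity
  -- theorem then covers the disk.
  have hconst : ∀ᶠ z in 𝓝 (w : ℂ), F z / G z = F w / G w := by
    refine Complex.eventually_eq_of_isLocalMax_norm (f := fun z => F z / G z) ?_ ?_
    · filter_upwards [hGne, isOpen_ball.eventually_mem hwb] with z hz hzb
      exact (hF.differentiableAt (isOpen_ball.mem_nhds hzb)).div
        (hG.differentiableAt (isOpen_ball.mem_nhds hzb)) hz
    · filter_upwards [hone] with z hz
      rw [Function.comp_apply, Function.comp_apply, hz, hone.self_of_nhds]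
  have heq : Set.EqOn F (fun z => F w / G w * G z) (ball 0 1) := by
    refine (hF.analyticOnNhd isOpen_ball).eqOn_of_preconnected_of_eventuallyEq
      ((hG.const_mul _).analyticOnNhd isOpen_ball) (convex_ball 0 1).isPreconnected hwb ?_
    filter_upwards [hconst, hGne] with z hz hz0
    rw [← hz, div_mul_cancel₀ _ hz0]
  refine ⟨⟨F w / G w, by simpa [Submonoid.unitSphere] using hone.self_of_nhds⟩, fun z => ?_⟩
  rw [← hFf, ← hGg]
  exact heq (by simpa using z.norm_lt_one)

theorem HTwo.isHoloFun (f : HTwo) : IsHoloFun f := by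
  refine ⟨fun z => ∑' n : ℕ, fourierCoeff (f : LTwo) n * z ^ n, fun z hz => ?_, fun z => rfl⟩
  obtain ⟨r, hzr, hr⟩ := exists_between (mem_ball_zero_iff.1 hz)
  have hr0 : 0 ≤ r := (norm_nonneg z).trans hzr.le
  refine DifferentiableAt.differentiableWithinAt ?_
  refine (differentiableOn_tsum_of_summable_norm (u := fun n => ‖f‖ * r ^ n)
    ((summable_geometric_of_lt_one hr0 hr).mul_left _) (fun n => by fun_prop) isOpen_ball
    fun n w hw => ?_).differentiableAt (isOpen_ball.mem_nhds (mem_ball_zero_iff.2 hzr))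
  rw [norm_mul, norm_pow]
  gcongr
  · exact norm_fourierCLM_le n f
  · exact (mem_ball_zero_iff.1 hw).le

theorem HTwo.continuous (f : HTwo) : Continuous f := (HTwo.isHoloFun f).continuous

/-! ### Blaschke products -/

/-- The modulus of a Blaschke factor, which is the pseudo-hyperbolic distance. -/
theorem norm_blaschkeFactor (a z : 𝔻) :
    ‖blaschkeFactor a z‖ = ‖((a : ℂ) - z) / (1 - conj (a : ℂ) * z)‖ := by
  obtain ⟨c, hc, hb⟩ := exists_unit_blaschkeFactor a
  rw [hb, norm_mul, hc, one_mul]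

theorem blaschkeFactor_eq_zero {a z : 𝔻} : blaschkeFactor a z = 0 ↔ a = z := by
  rw [← norm_eq_zero, norm_blaschkeFactor, norm_eq_zero, div_eq_zero_iff,
    or_iff_left (one_sub_conj_mul_ne_zero a z), sub_eq_zero, UnitDisc.coe_inj]

theorem norm_mobius_lt_one (a z : 𝔻) : ‖((a : ℂ) - z) / (1 - conj (a : ℂ) * z)‖ < 1 := by
  rw [norm_div, div_lt_one (norm_pos_iff.2 (one_sub_conj_mul_ne_zero a z)),
    ← sq_lt_sq₀ (norm_nonneg _) (norm_nonneg _), ← normSq_eq_norm_sq, ← normSq_eq_norm_sq]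
  have ha := a.normSq_lt_one
  have hz := z.normSq_lt_one
  have key : normSq (1 - conj (a : ℂ) * z) - normSq ((a : ℂ) - z) =
      (1 - normSq (a : ℂ)) * (1 - normSq (z : ℂ)) := by
    simp only [normSq_apply, sub_re, sub_im, one_re, one_im, mul_re, mul_im, conj_re, conj_im]
    ring
  nlinarith [mul_pos (sub_pos.2 ha) (sub_pos.2 hz)]

theorem norm_blaschkeFactor_lt_one (a z : 𝔻) : ‖blaschkeFactor a z‖ < 1 := by
  rw [norm_blaschkeFactor]
  exact norm_mobius_lt_one a z

/-- The normalization |a|/a makes the factor differ from 1 by a multiple of 1 - |a|; this turns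
convergence type into convergence of the product. -/
theorem norm_blaschkeFactor_sub_one_le (a z : 𝔻) :
    ‖blaschkeFactor a z - 1‖ ≤ 2 / (1 - ‖(z : ℂ)‖) * (1 - ‖(a : ℂ)‖) := by
  have hz : 0 < 1 - ‖(z : ℂ)‖ := sub_pos.2 z.norm_lt_one
  by_cases ha : a = 0
  · simp only [ha, blaschkeFactor, if_true, UnitDisc.coe_zero, norm_zero, sub_zero, mul_one]
    have h1 : ‖(z : ℂ) - 1‖ ≤ 2 := (norm_sub_le _ _).trans (by
      rw [norm_one]; linarith [z.norm_lt_one])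
    rw [le_div_iff₀ hz]
    nlinarith [norm_nonneg (z : ℂ), norm_nonneg ((z : ℂ) - 1)]
  · have ha0 : (a : ℂ) ≠ 0 := by simpa using ha
    have hd := one_sub_conj_mul_ne_zero a z
    have hconj : (a : ℂ) * conj (a : ℂ) = (‖(a : ℂ)‖ : ℂ) ^ 2 := by
      rw [mul_conj, normSq_eq_norm_sq]
      push_cast
      rfl
    have key : blaschkeFactor a z - 1 =
        -((1 - ‖(a : ℂ)‖) * (a + ‖(a : ℂ)‖ * z)) / (a * (1 - conj (a : ℂ) * z)) := by
      simp only [blaschkeFactor, ha, if_false]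
      rw [div_mul_div_comm, div_sub_one (mul_ne_zero ha0 hd)]
      congr 1
      linear_combination (z : ℂ) * hconj
    have hden : 1 - ‖(z : ℂ)‖ ≤ ‖1 - conj (a : ℂ) * z‖ := by
      have h1 := norm_sub_norm_le (1 : ℂ) (conj (a : ℂ) * z)
      rw [norm_one, norm_mul, RCLike.norm_conj] at h1
      nlinarith [norm_nonneg (z : ℂ), a.norm_lt_one]
    have hnum : ‖(a : ℂ) + ‖(a : ℂ)‖ * z‖ ≤ 2 * ‖(a : ℂ)‖ := by
      refine (norm_add_le _ _).trans ?_
      rw [norm_mul, norm_real, norm_norm]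
      nlinarith [norm_nonneg (a : ℂ), z.norm_lt_one]
    have h1a : ‖(1 : ℂ) - ‖(a : ℂ)‖‖ = 1 - ‖(a : ℂ)‖ := by
      rw [← ofReal_one, ← ofReal_sub, norm_real, Real.norm_of_nonneg]
      linarith [a.norm_lt_one]
    have h1a' : 0 ≤ 1 - ‖(a : ℂ)‖ := by linarith [a.norm_lt_one]
    have hapos : 0 < ‖(a : ℂ)‖ := norm_pos_iff.2 ha0
    rw [key, norm_div, norm_neg, norm_mul, norm_mul, h1a]
    calc (1 - ‖(a : ℂ)‖) * ‖(a : ℂ) + ‖(a : ℂ)‖ * z‖ / (‖(a : ℂ)‖ * ‖1 - conj (a : ℂ) * z‖)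
        ≤ (1 - ‖(a : ℂ)‖) * (2 * ‖(a : ℂ)‖) / (‖(a : ℂ)‖ * (1 - ‖(z : ℂ)‖)) := by gcongr
      _ = 2 / (1 - ‖(z : ℂ)‖) * (1 - ‖(a : ℂ)‖) := by field_simp

variable {A : Set 𝔻}

theorem summable_norm_blaschkeFactor_sub_one
    (hA : Summable fun ζ : A => 1 - ‖((ζ : 𝔻) : ℂ)‖) (z : 𝔻) :
    Summable fun ζ : A => ‖blaschkeFactor ζ z - 1‖ :=
  Summable.of_nonneg_of_le (fun _ => norm_nonneg _)
    (fun ζ => norm_blaschkeFactor_sub_one_le ζ z) (hA.mul_left _)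

theorem multipliable_blaschkeFactor (hA : Summable fun ζ : A => 1 - ‖((ζ : 𝔻) : ℂ)‖) (z : 𝔻) :
    Multipliable fun ζ : A => blaschkeFactor ζ z := by
  simpa using multipliable_one_add_of_summable (summable_norm_blaschkeFactor_sub_one hA z)

theorem tprod_blaschkeFactor_ne_zero (hA : Summable fun ζ : A => 1 - ‖((ζ : 𝔻) : ℂ)‖) {z : 𝔻}
    (hz : z ∉ A) : ∏' ζ : A, blaschkeFactor ζ z ≠ 0 := by
  have h := tprod_one_add_ne_zero_of_summable (f := fun ζ : A => blaschkeFactor ζ z - 1)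
    (fun ζ => by
      rw [add_sub_cancel, Ne, blaschkeFactor_eq_zero]
      rintro rfl
      exact hz ζ.2) (summable_norm_blaschkeFactor_sub_one hA z)
  simpa using h

/-- A summable family of positive terms has a countable index set. Density off the zeros is all that
is needed to cancel a Blaschke product in identities of continuous functions. -/
theorem dense_compl_of_summable (hA : Summable fun ζ : A => 1 - ‖((ζ : 𝔻) : ℂ)‖) :
    Dense Aᶜ := by
  have hcount : A.Countable := by
    have h := hA.countable_support
    rw [Function.support_eq_univ (fun ζ => (sub_pos.2 (UnitDisc.norm_lt_one _)).ne'),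
      Set.countable_univ_iff] at h
    exact h
  have hd : Dense ((UnitDisc.coe '' A)ᶜ : Set ℂ) := (hcount.image _).dense_compl ℝ
  have hopen : IsOpenEmbedding (UnitDisc.coe : 𝔻 → ℂ) := isOpen_ball.isOpenEmbedding_subtypeVal
  have h := hd.preimage hopen.isOpenMap
  rwa [Set.preimage_compl, Set.preimage_image_eq _ UnitDisc.coe_injective] at h

/-- Multiplication by a Blaschke product with simple zeros is isometric on `H²`, and its range
consists of the functions that vanish at the zeros of the product. -/
theorem exists_linearIsometry_blaschkeProduct (hA : Summable fun ζ : A => 1 - ‖((ζ : 𝔻) : ℂ)‖) :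
    ∃ T : HTwo →ₗᵢ[ℂ] HTwo,
      (∀ (f : HTwo) (z : 𝔻), T f z = (∏' ζ : A, blaschkeFactor ζ z) * f z) ∧
        ∀ f : HTwo, (∀ ζ ∈ A, f ζ = 0) → ∃ g, T g = f := by
  obtain ⟨T, hT, hTr⟩ := exists_linearIsometry_tprod (H := HTwo)
    (b := fun ζ : A => blaschkeFactor ζ) (p := fun ζ : A => (ζ : 𝔻))
    (fun ζ => HTwo.exists_linearIsometry_blaschkeFactor ζ)
    (fun ζ ξ => by rw [blaschkeFactor_eq_zero, Subtype.coe_inj])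
    (fun z => (multipliable_blaschkeFactor hA z).hasProd)
    (fun f hf => RKHS.ext fun z => by
      have h : (⇑f : 𝔻 → ℂ) = fun _ => 0 :=
        (HTwo.continuous f).ext_on (dense_compl_of_summable hA) continuous_const fun z hz =>
          (mul_eq_zero.1 (hf z)).resolve_left (tprod_blaschkeFactor_ne_zero hA hz)
      rw [h, RKHS.coe_zero]
      rfl)
  exact ⟨T, hT, fun f hf => hTr f fun ζ => hf ζ ζ.2⟩

/-- The product is the image of the constant 1 under its own multiplication operator, so it lies in
H². -/
theorem isHoloFun_blaschkeProduct (hA : Summable fun ζ : A => 1 - ‖((ζ : 𝔻) : ℂ)‖) :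
    IsHoloFun fun z => ∏' ζ : A, blaschkeFactor ζ z := by
  obtain ⟨T, hT, -⟩ := exists_linearIsometry_blaschkeProduct hA
  have h : (fun z => ∏' ζ : A, blaschkeFactor ζ z) = T (monomial 0) :=
    funext fun z => by rw [hT, monomial_zero_apply, mul_one]
  rw [h]
  exact HTwo.isHoloFun _

theorem norm_blaschkeProduct_le (hA : Summable fun ζ : A => 1 - ‖((ζ : 𝔻) : ℂ)‖) (z : 𝔻) (ξ : A) :
    ‖∏' ζ : A, blaschkeFactor ζ z‖ ≤ ‖blaschkeFactor ξ z‖ := by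
  classical
  have h := (multipliable_blaschkeFactor hA z).hasProd.norm
  have h' : Tendsto (fun s : Finset A => ∏ ζ ∈ s, ‖blaschkeFactor ζ z‖) atTop
      (𝓝 ‖∏' ζ : A, blaschkeFactor ζ z‖) := by simpa [HasProd] using h
  refine le_of_tendsto h' ?_
  filter_upwards [eventually_ge_atTop {ξ}] with s hs
  rw [← Finset.mul_prod_erase s _ (hs (Finset.mem_singleton_self ξ))]
  exact mul_le_of_le_one_right (norm_nonneg _)
    (Finset.prod_le_one (fun _ _ => norm_nonneg _) fun ζ _ => (norm_blaschkeFactor_lt_one ζ z).le)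

/-! ### The Schwarz–Pick lemma -/

theorem IsHolo.comp {φ ψ : 𝔻 → 𝔻} (hφ : IsHolo φ) (hψ : IsHolo ψ) : IsHolo (φ ∘ ψ) :=
  IsHoloFun.comp (f := fun z => (φ z : ℂ)) hφ hψ

theorem IsHolo.norm_le_norm {φ : 𝔻 → 𝔻} (hφ : IsHolo φ) (h0 : φ 0 = 0) (z : 𝔻) :
    ‖(φ z : ℂ)‖ ≤ ‖(z : ℂ)‖ := by
  obtain ⟨F, hF, hFφ⟩ := hφ
  rw [← hFφ]
  refine Complex.norm_le_norm_of_mapsTo_ball hF (fun w hw => ?_) ?_ z.norm_lt_one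
  · lift w to 𝔻 using by simpa using hw
    rw [hFφ]
    simpa using (φ w).norm_lt_one.le
  · have h := hFφ 0
    rwa [h0, UnitDisc.coe_zero] at h

/-- The involution of the disk that exchanges `0` and `a`. -/
def mobius (a z : 𝔻) : 𝔻 := UnitDisc.mk _ (norm_mobius_lt_one a z)

theorem coe_mobius (a z : 𝔻) :
    (mobius a z : ℂ) = ((a : ℂ) - z) / (1 - conj (a : ℂ) * z) := rfl

theorem norm_mobius (a z : 𝔻) : ‖(mobius a z : ℂ)‖ = ‖blaschkeFactor a z‖ :=
  (norm_blaschkeFactor a z).symm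

theorem isHolo_mobius (a : 𝔻) : IsHolo (mobius a) := by
  refine ⟨fun z => ((a : ℂ) - z) / (1 - conj (a : ℂ) * z), ?_, fun z => rfl⟩
  refine DifferentiableOn.div (by fun_prop) (by fun_prop) fun z hz => ?_
  lift z to 𝔻 using by simpa using hz
  exact one_sub_conj_mul_ne_zero a z

theorem mobius_zero (a : 𝔻) : mobius a 0 = a := UnitDisc.coe_injective (by simp [coe_mobius])

theorem mobius_self (a : 𝔻) : mobius a a = 0 := UnitDisc.coe_injective (by simp [coe_mobius])

theorem mobius_mobius (a z : 𝔻) : mobius a (mobius a z) = z := by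
  apply UnitDisc.coe_injective
  have h1 := one_sub_conj_mul_ne_zero a z
  have h2 := one_sub_conj_mul_ne_zero a (mobius a z)
  have hm : (mobius a z : ℂ) * (1 - conj (a : ℂ) * z) = a - z := div_mul_cancel₀ _ h1
  rw [coe_mobius, div_eq_iff h2]
  refine mul_right_cancel₀ h1 ?_
  linear_combination (-1 + z * conj (a : ℂ)) * hm

/-- The **Schwarz–Pick lemma**. -/
theorem IsHolo.norm_blaschkeFactor_le {φ : 𝔻 → 𝔻} (hφ : IsHolo φ) (w z : 𝔻) :
    ‖blaschkeFactor (φ w) (φ z)‖ ≤ ‖blaschkeFactor w z‖ := by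
  -- Conjugation by the involutions at w and φ(w) reduces to a map fixing 0, where the Schwarz lemma
  -- applies.
  have h := ((isHolo_mobius (φ w)).comp (hφ.comp (isHolo_mobius w))).norm_le_norm
    (by simp [mobius_zero, mobius_self]) (mobius w z)
  simpa [mobius_mobius, norm_mobius] using h

theorem isHolo_smul (γ : DiskAut) : IsHolo fun z => γ • z := γ.2.1

theorem norm_blaschkeFactor_smul (γ : DiskAut) (w z : 𝔻) :
    ‖blaschkeFactor (γ • w) (γ • z)‖ = ‖blaschkeFactor w z‖ := by
  refine le_antisymm ((isHolo_smul γ).norm_blaschkeFactor_le w z) ?_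
  have h := (isHolo_smul γ⁻¹).norm_blaschkeFactor_le (γ • w) (γ • z)
  simpa using h

theorem blaschkeFactor_zero (z : 𝔻) : blaschkeFactor 0 z = z := by simp [blaschkeFactor]

theorem exists_ne_zero : ∃ w : 𝔻, w ≠ 0 :=
  ⟨UnitDisc.mk (1 / 2) (by norm_num), fun h => by simpa using congrArg UnitDisc.coe h⟩

/-- An automorphism of the disk that fixes the origin is a rotation. -/
theorem exists_rotation {γ : DiskAut} (hγ : γ • (0 : 𝔻) = 0) :
    ∃ c : Circle, ∀ z : 𝔻, γ • z = c • z := by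
  obtain ⟨w, hw⟩ := exists_ne_zero
  obtain ⟨c, hc⟩ := IsHoloFun.exists_unit_mul (f := fun z => ((γ • z : 𝔻) : ℂ))
    (g := fun z => (z : ℂ)) (isHolo_smul γ) ⟨id, differentiableOn_id, fun _ => rfl⟩ (fun z => by
      have h := norm_blaschkeFactor_smul γ 0 z
      rwa [hγ, blaschkeFactor_zero, blaschkeFactor_zero] at h) (w := w) (by simpa using hw)
  exact ⟨c, fun z => UnitDisc.coe_injective (hc z)⟩

/-! ### The stabilizer of the origin -/

theorem continuous_circle_smul : Continuous fun p : Circle × 𝔻 => p.1 • p.2 := by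
  rw [UnitDisc.isEmbedding_coe.continuous_iff]
  exact (continuous_subtype_val.comp continuous_fst).mul
    (UnitDisc.continuous_coe.comp continuous_snd)

theorem isHolo_circle_smul (c : Circle) : IsHolo fun z => c • z :=
  ⟨fun z => c * z, by fun_prop, fun _ => rfl⟩

/-- Rotations as automorphisms of the disk. -/
def rotation : Circle →* DiskAut where
  toFun c := ⟨
    { toFun := fun z => c • z
      invFun := fun z => c⁻¹ • z
      left_inv := inv_smul_smul c
      right_inv := smul_inv_smul c
      continuous_toFun := continuous_circle_smul.comp (Continuous.prodMk_right c)
      continuous_invFun := continuous_circle_smul.comp (Continuous.prodMk_right c⁻¹) },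
    isHolo_circle_smul c, isHolo_circle_smul c⁻¹⟩
  map_one' := Subtype.ext (Homeomorph.ext fun z => one_smul Circle z)
  map_mul' c d := Subtype.ext (Homeomorph.ext fun z => mul_smul c d z)

theorem continuous_rotation : Continuous rotation := by
  rw [continuous_induced_rng]
  exact (ContinuousMap.curry ⟨_, continuous_circle_smul⟩).continuous

theorem diskAut_ext {γ δ : DiskAut} (h : ∀ z : 𝔻, γ • z = δ • z) : γ = δ :=
  Subtype.ext (Homeomorph.ext h)

theorem circle_ext {c d : Circle} {w : 𝔻} (hw : w ≠ 0) (h : c • w = d • w) : c = d := by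
  have h' : (c : ℂ) * w = d * w := congrArg UnitDisc.coe h
  exact Circle.ext (mul_right_cancel₀ (by simpa using hw) h')

theorem rotation_injective : Function.Injective rotation := by
  intro c d h
  obtain ⟨w, hw⟩ := exists_ne_zero
  exact circle_ext hw (congrArg (fun γ : DiskAut => γ • w) h)

variable {Γ : Subgroup DiskAut}

/-- The stabilizer consists of rotations, and the rotations in Γ form a discrete, hence closed,
subgroup of the compact circle. -/
theorem finite_stabilizer (hΓ : IsFuchsian Γ) : Finite (MulAction.stabilizer Γ (0 : 𝔻)) := by
  have : DiscreteTopology Γ := hΓ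
  let R : Subgroup Circle := Γ.comap rotation
  let r : R → Γ := fun c => ⟨rotation c, c.2⟩
  have hr : Continuous r := (continuous_rotation.comp continuous_subtype_val).subtype_mk _
  have hri : Function.Injective r := fun c d h =>
    Subtype.ext (rotation_injective (congrArg Subtype.val h))
  have : DiscreteTopology R := DiscreteTopology.of_continuous_injective hr hri
  have : CompactSpace R := isCompact_iff_compactSpace.1
    (Subgroup.isClosed_of_discrete (H := R)).isCompact
  have : Finite R := finite_of_compact_of_discrete
  refine Set.Finite.to_subtype ((Set.finite_range r).subset fun γ hγ => ?_)
  obtain ⟨c, hc⟩ := exists_rotation (γ := (γ : DiskAut)) hγ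
  have h : rotation c = γ := diskAut_ext fun z => (hc z).symm
  exact ⟨⟨c, by rw [Subgroup.mem_comap, h]; exact γ.2⟩, Subtype.ext h⟩

/-! ### The character of the orbit -/

/-- γ permutes the orbit and preserves the pseudo-hyperbolic distance, so it only permutes the
moduli of the factors. -/
theorem norm_orbitBlaschke_smul (hconv : IsConvergenceType Γ) (γ : Γ) (z : 𝔻) :
    ‖orbitBlaschke Γ (γ • z)‖ = ‖orbitBlaschke Γ z‖ := by
  have hn : ∀ z, ‖orbitBlaschke Γ z‖ =
      ∏' ζ : MulAction.orbit Γ (0 : 𝔻), ‖blaschkeFactor ζ z‖ := fun z =>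
    (multipliable_blaschkeFactor hconv z).norm_tprod
  rw [hn, hn, ← Equiv.tprod_eq (MulAction.toPerm γ : Equiv.Perm (MulAction.orbit Γ (0 : 𝔻)))]
  exact tprod_congr fun ζ => norm_blaschkeFactor_smul γ ζ z

theorem exists_orbitBlaschke_ne_zero (hconv : IsConvergenceType Γ) :
    ∃ w, orbitBlaschke Γ w ≠ 0 := by
  obtain ⟨w, hw⟩ := (dense_compl_of_summable hconv).nonempty
  exact ⟨w, tprod_blaschkeFactor_ne_zero hconv hw⟩

theorem exists_isOrbitCharacter (hΓ : IsFuchsian Γ) (hconv : IsConvergenceType Γ) :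
    ∃ σ₀ : Γ →ₜ* Circle, IsOrbitCharacter Γ σ₀ := by
  have : DiscreteTopology Γ := hΓ
  obtain ⟨w, hw⟩ := exists_orbitBlaschke_ne_zero hconv
  have hB : IsHoloFun (orbitBlaschke Γ) := isHoloFun_blaschkeProduct hconv
  choose c hc using fun γ : Γ => (hB.comp (isHolo_smul γ)).exists_unit_mul hB
    (norm_orbitBlaschke_smul hconv γ) hw
  have hc' : ∀ (γ : Γ) z, orbitBlaschke Γ (γ • z) = c γ * orbitBlaschke Γ z := hc
  refine ⟨⟨MonoidHom.mk' c fun γ δ => ?_, continuous_of_discreteTopology⟩, hc'⟩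
  have h := hc' (γ * δ) w
  rw [mul_smul, hc', hc', ← mul_assoc] at h
  exact Circle.ext (mul_right_cancel₀ hw h).symm

theorem IsOrbitCharacter.eq {χ χ' : Γ →ₜ* Circle} (hconv : IsConvergenceType Γ)
    (h : IsOrbitCharacter Γ χ) (h' : IsOrbitCharacter Γ χ') : χ = χ' := by
  obtain ⟨w, hw⟩ := exists_orbitBlaschke_ne_zero hconv
  ext γ
  exact mul_right_cancel₀ hw ((h γ w).symm.trans (h' γ w))

theorem summable_of_subset {A A' : Set 𝔻} (hAA' : A ⊆ A')
    (hA' : Summable fun ζ : A' => 1 - ‖((ζ : 𝔻) : ℂ)‖) :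
    Summable fun ζ : A => 1 - ‖((ζ : 𝔻) : ℂ)‖ :=
  hA'.comp_injective (i := Set.inclusion hAA') (Set.inclusion_injective hAA')

theorem zero_mem_orbit : (0 : 𝔻) ∈ MulAction.orbit Γ (0 : 𝔻) := MulAction.mem_orbit_self _

/-- The orbit Blaschke product has a simple zero at the origin. -/
theorem exists_orbitBlaschke_eq_mul (hconv : IsConvergenceType Γ) :
    ∃ C : 𝔻 → ℂ, Continuous C ∧ C 0 ≠ 0 ∧ ∀ z, orbitBlaschke Γ z = z * C z := by
  have hA : Summable fun ζ : (MulAction.orbit Γ (0 : 𝔻) \ {0} : Set 𝔻) => 1 - ‖((ζ : 𝔻) : ℂ)‖ :=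
    summable_of_subset Set.sdiff_subset hconv
  refine ⟨fun z => ∏' ζ : (MulAction.orbit Γ (0 : 𝔻) \ {0} : Set 𝔻), blaschkeFactor ζ z,
    (isHoloFun_blaschkeProduct hA).continuous,
    tprod_blaschkeFactor_ne_zero hA (by simp), fun z => ?_⟩
  have hu : {0} ∪ (MulAction.orbit Γ (0 : 𝔻) \ {0}) = MulAction.orbit Γ (0 : 𝔻) :=
    Set.union_sdiff_cancel (Set.singleton_subset_iff.2 zero_mem_orbit)
  have h := Multipliable.tprod_union_disjoint (f := fun ζ => blaschkeFactor ζ z)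
    (s := {0}) (t := MulAction.orbit Γ (0 : 𝔻) \ {0}) Set.disjoint_sdiff_right
    (Multipliable.of_finite ..) (multipliable_blaschkeFactor hA z)
  rw [hu, tprod_singleton (0 : 𝔻) (fun ζ => blaschkeFactor ζ z), blaschkeFactor_zero] at h
  exact h

theorem norm_orbitBlaschke_le (hconv : IsConvergenceType Γ) (z : 𝔻) :
    ‖orbitBlaschke Γ z‖ ≤ ‖(z : ℂ)‖ :=
  (norm_blaschkeProduct_le hconv z ⟨0, zero_mem_orbit⟩).trans_eq (by rw [blaschkeFactor_zero])

/-- On the stabilizer of the origin the orbit character is the derivative at the origin. -/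
theorem IsOrbitCharacter.eq_of_rotation {σ₀ : Γ →ₜ* Circle} (hconv : IsConvergenceType Γ)
    (h : IsOrbitCharacter Γ σ₀) {γ : Γ} {c : Circle} (hγ : ∀ z : 𝔻, γ • z = c • z) :
    σ₀ γ = c := by
  obtain ⟨C, hC, hC0, hBC⟩ := exists_orbitBlaschke_eq_mul hconv
  -- With B_0 = zC, cancelling z leaves c C(cz) = σ_0(γ) C(z) off 0; by continuity it holds at 0,
  -- where C ≠ 0.
  have hne : ∀ z : 𝔻, z ≠ 0 → (c : ℂ) * C (c • z) = σ₀ γ * C z := fun z hz => by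
    have h1 := h γ z
    rw [hγ, hBC, hBC, UnitDisc.coe_circle_smul] at h1
    have hz' : (z : ℂ) ≠ 0 := by simpa using hz
    exact mul_left_cancel₀ hz' (by linear_combination h1)
  have hcont : Continuous fun z : 𝔻 => (c : ℂ) * C (c • z) :=
    continuous_const.mul (hC.comp (continuous_circle_smul.comp (Continuous.prodMk_right c)))
  have hdense : Dense ({0}ᶜ : Set 𝔻) :=
    dense_compl_of_summable (A := {0}) (Summable.of_finite ..)
  have h0 := congrFun (hcont.ext_on hdense (continuous_const.mul hC) fun z hz => hne z hz) 0
  have hc0 : c • (0 : 𝔻) = 0 := UnitDisc.coe_injective (by simp)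
  simp only [hc0] at h0
  exact Circle.ext (mul_right_cancel₀ hC0 h0).symm

theorem IsOrbitCharacter.injective_stabilizer {σ₀ : Γ →ₜ* Circle} (hconv : IsConvergenceType Γ)
    (h : IsOrbitCharacter Γ σ₀) {γ : Γ} (hγ : γ ∈ MulAction.stabilizer Γ (0 : 𝔻))
    (h1 : σ₀ γ = 1) : γ = 1 := by
  obtain ⟨c, hc⟩ := exists_rotation (γ := (γ : DiskAut)) hγ
  rw [h.eq_of_rotation hconv (c := c) hc] at h1
  exact Subtype.ext (diskAut_ext fun z => (hc z).trans (by rw [h1, one_smul]; rfl))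

/-- The stabilizer of the origin contains an element on which no power of the orbit character of
exponent strictly between `0` and the order of the stabilizer is trivial. -/
theorem IsOrbitCharacter.exists_generator {σ₀ : Γ →ₜ* Circle} (hΓ : IsFuchsian Γ)
    (hconv : IsConvergenceType Γ) (h : IsOrbitCharacter Γ σ₀) :
    ∃ γ ∈ MulAction.stabilizer Γ (0 : 𝔻), ∀ j, σ₀ γ ^ j = 1 → stabOrder Γ ∣ j := by
  have := finite_stabilizer hΓ
  -- Mapping into the field ℂ is what yields cyclicity: a finite group embedded multiplicatively in
  -- a domain is cyclic.
  let f : MulAction.stabilizer Γ (0 : 𝔻) →* ℂ :=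
    Circle.coeHom.comp (σ₀.toMonoidHom.comp (MulAction.stabilizer Γ (0 : 𝔻)).subtype)
  have hker : ∀ γ : MulAction.stabilizer Γ (0 : 𝔻), σ₀ γ = 1 → γ = 1 := fun γ hγ =>
    Subtype.ext (h.injective_stabilizer hconv γ.2 hγ)
  have hf : Function.Injective f := by
    intro γ δ hγδ
    have h1 : σ₀ γ = σ₀ δ := Circle.ext hγδ
    refine mul_inv_eq_one.1 (hker _ ?_)
    rw [Subgroup.coe_mul, Subgroup.coe_inv, map_mul, map_inv, h1, mul_inv_cancel]
  have : IsCyclic (MulAction.stabilizer Γ (0 : 𝔻)) := isCyclic_of_injective_ringHom f hf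
  obtain ⟨g, hg⟩ := IsCyclic.exists_ofOrder_eq_natCard (α := MulAction.stabilizer Γ (0 : 𝔻))
  refine ⟨g, g.2, fun j hj => ?_⟩
  rw [stabOrder, ← hg]
  refine orderOf_dvd_of_pow_eq_one (hker _ ?_)
  rw [Subgroup.coe_pow, map_pow, hj]

theorem pow_stabOrder_apply (χ : Γ →ₜ* Circle) {γ : Γ}
    (hγ : γ ∈ MulAction.stabilizer Γ (0 : 𝔻)) : χ γ ^ stabOrder Γ = 1 := by
  have h : (⟨γ, hγ⟩ : MulAction.stabilizer Γ (0 : 𝔻)) ^ stabOrder Γ = 1 := pow_card_eq_one'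
  have h' : γ ^ stabOrder Γ = 1 := congrArg Subtype.val h
  rw [← map_pow, h', map_one]

/-! ### Division in the character automorphic Hardy spaces -/

theorem mem_HSigma {τ : Γ →ₜ* Circle} {f : HTwo} :
    f ∈ HSigma Γ τ ↔ ∀ (γ : Γ) (z : 𝔻), f (γ • z) = (τ γ : ℂ) * f z := Iff.rfl

theorem continuous_smul_disc (γ : Γ) : Continuous fun z : 𝔻 => γ • z :=
  ((γ : DiskAut) : 𝔻 ≃ₜ 𝔻).continuous

theorem character_div_pow_apply (τ σ₀ : Γ →ₜ* Circle) (n : ℕ) (γ : Γ) :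
    (τ / σ₀ ^ n) γ = τ γ / σ₀ γ ^ n := by
  have h : (σ₀ ^ n) γ = σ₀ γ ^ n := by
    induction n with
    | zero => rw [pow_zero, pow_zero]; rfl
    | succ n ih => rw [pow_succ, pow_succ, ← ih]; rfl
  rw [← h]
  rfl

theorem pow_apply_of_forall {T : HTwo →ₗᵢ[ℂ] HTwo} {B : 𝔻 → ℂ}
    (hT : ∀ (f : HTwo) (z : 𝔻), T f z = B z * f z) (n : ℕ) (f : HTwo) (z : 𝔻) :
    (T ^ n) f z = B z ^ n * f z := by
  induction n with
  | zero => rw [pow_zero, pow_zero, one_mul]; rfl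
  | succ n ih =>
    have h : (T ^ (n + 1)) f = T ((T ^ n) f) := by rw [pow_succ']; rfl
    rw [h, hT, ih]
    ring

theorem pow_mem_HSigma {σ₀ : Γ →ₜ* Circle} (hσ₀ : IsOrbitCharacter Γ σ₀)
    {T : HTwo →ₗᵢ[ℂ] HTwo} (hT : ∀ (f : HTwo) (z : 𝔻), T f z = orbitBlaschke Γ z * f z)
    (τ : Γ →ₜ* Circle) (n : ℕ) {f : HTwo} (hf : f ∈ HSigma Γ (τ / σ₀ ^ n)) :
    (T ^ n) f ∈ HSigma Γ τ := by
  intro γ z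
  rw [pow_apply_of_forall hT, pow_apply_of_forall hT, hσ₀ γ z, mem_HSigma.1 hf γ z]
  rw [character_div_pow_apply, Circle.coe_div, Circle.coe_pow, mul_pow]
  field_simp [Circle.coe_ne_zero]

/-- Automorphy spreads the zero at 0 over the orbit. The law for the quotient follows by cancelling
B_0 off the orbit and extending by density. -/
theorem exists_mem_HSigma_of_apply_zero (hconv : IsConvergenceType Γ) {σ₀ : Γ →ₜ* Circle}
    (hσ₀ : IsOrbitCharacter Γ σ₀) {T : HTwo →ₗᵢ[ℂ] HTwo}
    (hT : ∀ (f : HTwo) (z : 𝔻), T f z = orbitBlaschke Γ z * f z)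
    (hTr : ∀ f : HTwo, (∀ ζ ∈ MulAction.orbit Γ (0 : 𝔻), f ζ = 0) → ∃ g, T g = f)
    {τ : Γ →ₜ* Circle} {f : HTwo} (hf : f ∈ HSigma Γ τ) (hf0 : f 0 = 0) :
    ∃ g ∈ HSigma Γ (τ / σ₀), T g = f := by
  obtain ⟨g, rfl⟩ := hTr f (by
    rintro _ ⟨γ, rfl⟩
    exact (hf γ 0).trans (by rw [hf0, mul_zero]))
  refine ⟨g, fun γ z => ?_, rfl⟩
  have h := ((HTwo.continuous g).comp (continuous_smul_disc γ)).ext_on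
    (dense_compl_of_summable hconv)
    ((continuous_const (y := ((τ / σ₀) γ : ℂ))).mul (HTwo.continuous g)) fun z hz => by
      have hz0 : orbitBlaschke Γ z ≠ 0 := tprod_blaschkeFactor_ne_zero hconv hz
      have h1 := mem_HSigma.1 hf γ z
      rw [hT, hT, hσ₀ γ z] at h1
      have hs : (σ₀ γ : ℂ) ≠ 0 := Circle.coe_ne_zero _
      have h2 : ((τ / σ₀) γ : ℂ) = τ γ / (σ₀ γ : ℂ) := rfl
      change g (γ • z) = ((τ / σ₀) γ : ℂ) * g z
      rw [h2, div_mul_eq_mul_div, eq_div_iff hs]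
      exact mul_left_cancel₀ hz0 (by linear_combination h1)
  exact congrFun h z

theorem exists_mem_HSigma_of_apply_zero_of_stabilizer (hΓ : IsFuchsian Γ)
    (hconv : IsConvergenceType Γ) {σ₀ : Γ →ₜ* Circle}
    (hσ₀ : IsOrbitCharacter Γ σ₀) {T : HTwo →ₗᵢ[ℂ] HTwo}
    (hT : ∀ (f : HTwo) (z : 𝔻), T f z = orbitBlaschke Γ z * f z)
    (hTr : ∀ f : HTwo, (∀ ζ ∈ MulAction.orbit Γ (0 : 𝔻), f ζ = 0) → ∃ g, T g = f)
    {τ : Γ →ₜ* Circle} (hτ : ∀ γ ∈ MulAction.stabilizer Γ (0 : 𝔻), τ γ = 1)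
    {f : HTwo} (hf : f ∈ HSigma Γ τ) (hf0 : f 0 = 0) :
    ∃ g ∈ HSigma Γ (τ / σ₀ ^ stabOrder Γ), (T ^ stabOrder Γ) g = f := by
  obtain ⟨ω, hω, hωj⟩ := hσ₀.exists_generator hΓ hconv
  suffices h : ∀ j ≤ stabOrder Γ, ∃ g ∈ HSigma Γ (τ / σ₀ ^ j), (T ^ j) g = f from h _ le_rfl
  intro j
  induction j with
  | zero =>
    intro _
    refine ⟨f, ?_, rfl⟩
    rwa [pow_zero, div_one]
  | succ j ih =>
    intro hj
    obtain ⟨g, hg, hgf⟩ := ih (by omega)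
    have hg0 : g 0 = 0 := by
      rcases Nat.eq_zero_or_pos j with rfl | hj0
      · rw [← hgf] at hf0
        exact hf0
      -- At the fixed point 0 of ω, g(0) ≠ 0 would give σ_0(ω)^j = 1, so m ∣ j, against 0 < j < m.
      · have h1 := mem_HSigma.1 hg ω 0
        rw [MulAction.mem_stabilizer_iff.1 hω, character_div_pow_apply, hτ ω hω, Circle.coe_div,
          Circle.coe_pow, Circle.coe_one] at h1
        by_contra hne
        have h3 : 1 / (σ₀ ω : ℂ) ^ j = 1 := mul_right_cancel₀ hne (by rw [one_mul]; exact h1.symm)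
        rw [one_div, inv_eq_one] at h3
        have h4 := Nat.le_of_dvd hj0 (hωj j (Circle.ext (by simpa using h3)))
        omega
    obtain ⟨k, hk, hkg⟩ := exists_mem_HSigma_of_apply_zero hconv hσ₀ hT hTr hg hg0
    refine ⟨k, ?_, ?_⟩
    · rwa [pow_succ, ← div_div]
    · rw [pow_succ, ← hgf, ← hkg]
      rfl

/-! ### Kernel functions -/

theorem normalize_eq_zero_or {E : Type*} [NormedAddCommGroup E] [NormedSpace ℂ E] (k : E) :
    ((‖k‖⁻¹ : ℝ) : ℂ) • k = 0 ∨ ‖((‖k‖⁻¹ : ℝ) : ℂ) • k‖ = 1 := by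
  by_cases h : k = 0
  · simp [h]
  · right
    rw [norm_smul, norm_real, norm_inv, norm_norm, inv_mul_cancel₀ (norm_ne_zero_iff.2 h)]

section Kernel

variable (M : Submodule ℂ HTwo) [CompleteSpace M]

theorem inner_kernelFun (w : 𝔻) (f : M) : ⟪kernelFun M w, f⟫_ℂ = f w := by
  rw [kernelFun]
  exact (RKHS.kerFun_inner (H := M) w (1 : ℂ) f).trans (by simp)

theorem inner_normKernelFun (w : 𝔻) (f : M) :
    ⟪normKernelFun M w, f⟫_ℂ = ((‖kernelFun M w‖⁻¹ : ℝ) : ℂ) * f w := by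
  rw [normKernelFun]
  refine (inner_smul_left (𝕜 := ℂ) (E := M) _ _ _).trans ?_
  rw [inner_kernelFun, conj_ofReal]

theorem normKernelFun_eq_zero_or (w : 𝔻) : normKernelFun M w = 0 ∨ ‖normKernelFun M w‖ = 1 :=
  normalize_eq_zero_or (E := M) (kernelFun M w)

/-- If the kernel function is zero, every function of M vanishes at w, so the degenerate case needs
no separate treatment. -/
theorem apply_eq_zero_of_inner_normKernelFun {w : 𝔻} {f : M}
    (h : ⟪normKernelFun M w, f⟫_ℂ = 0) : f w = 0 := by
  rw [inner_normKernelFun, mul_eq_zero, ofReal_eq_zero, inv_eq_zero] at h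
  refine h.elim (fun h0 => ?_) id
  rw [← inner_kernelFun, (norm_eq_zero (E := M)).1 h0]
  exact inner_zero_left (𝕜 := ℂ) (E := M) _

end Kernel

/-- No nonzero function in `H²` is divisible by all powers of a function bounded by `|z|`. -/
theorem eq_zero_of_forall_exists_pow {T : HTwo →ₗᵢ[ℂ] HTwo} {B : 𝔻 → ℂ}
    (hT : ∀ (f : HTwo) (z : 𝔻), T f z = B z * f z) (hB : ∀ z, ‖B z‖ ≤ ‖(z : ℂ)‖) {f : HTwo}
    (hf : ∀ n, ∃ g, (T ^ n) g = f) : f = 0 := by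
  refine RKHS.ext fun z => ?_
  rw [RKHS.coe_zero, Pi.zero_apply, ← norm_le_zero_iff]
  have hlim : Tendsto (fun n : ℕ => ‖(z : ℂ)‖ ^ n * (‖f‖ * √‖RKHS.kernel HTwo z z‖)) atTop
      (𝓝 (0 * (‖f‖ * √‖RKHS.kernel HTwo z z‖))) :=
    (tendsto_pow_atTop_nhds_zero_of_lt_one (norm_nonneg _) z.norm_lt_one).mul_const _
  rw [zero_mul] at hlim
  refine ge_of_tendsto' hlim fun n => ?_
  obtain ⟨g, rfl⟩ := hf n
  -- As Tⁿ is isometric, ‖g‖ = ‖Tⁿ g‖, so the bound on g(z) does not depend on n.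
  rw [pow_apply_of_forall hT, norm_mul, norm_pow, (T ^ n).norm_map]
  gcongr
  · exact hB z
  · exact RKHS.norm_apply_le (H := HTwo) g z

end CharHardy

end

theorem proposition2p8 (Γ : Subgroup DiskAut) (hΓ : IsFuchsian Γ) (hconv : IsConvergenceType Γ)
    (σ : Γ →ₜ* Circle) (hσ : ∃ f : HSigma Γ σ, f (0 : Complex.UnitDisc) ≠ 0) :
    ∃ σ₀ : Γ →ₜ* Circle, (∀ χ : Γ →ₜ* Circle, IsOrbitCharacter Γ χ ↔ χ = σ₀) ∧
      ∃ b : HilbertBasis {n : ℕ // basisFun Γ σ σ₀ n ≠ 0} ℂ (HSigma Γ σ),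
        ∀ n, ⇑(b n) = basisFun Γ σ σ₀ n := by
  obtain ⟨σ₀, hσ₀⟩ := exists_isOrbitCharacter hΓ hconv
  refine ⟨σ₀, fun χ => ⟨fun h => h.eq hconv hσ₀, fun h => h ▸ hσ₀⟩, ?_⟩
  obtain ⟨T, hT, hTr⟩ := exists_linearIsometry_blaschkeProduct hconv
  have hT' : ∀ (f : HTwo) z, T f z = orbitBlaschke Γ z * f z := hT
  have := finite_stabilizer hΓ
  -- `Nat.card` of an infinite type is 0, so finiteness matters: m ≥ 1 is what gives |B_Γ(z)| ≤ |z|.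
  have hm : 0 < stabOrder Γ := Nat.card_pos
  let M : ℕ → Submodule ℂ HTwo := fun n => HSigma Γ (σ / σ₀ ^ (stabOrder Γ * n))
  let κ : ∀ n, M n := fun n => normKernelFun (HSigma Γ (σ / σ₀ ^ (stabOrder Γ * n))) 0
  have hM : ∀ n, M (n + 1) = HSigma Γ (σ / σ₀ ^ (stabOrder Γ * n) / σ₀ ^ stabOrder Γ) := fun n => by
    simp only [M]
    rw [mul_add, mul_one, pow_add, div_div]
  have hM₀ : M 0 = HSigma Γ σ := by
    simp only [M]
    rw [mul_zero, pow_zero, div_one]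
  -- At the fixed point 0, automorphy reads f(0) = σ(γ) f(0) with f(0) ≠ 0.
  have hσ1 : ∀ γ ∈ MulAction.stabilizer Γ (0 : Complex.UnitDisc), σ γ = 1 := by
    intro γ hγ
    obtain ⟨f, hf⟩ := hσ
    have h := mem_HSigma.1 f.2 γ 0
    rw [MulAction.mem_stabilizer_iff.1 hγ] at h
    exact Circle.ext (mul_right_cancel₀ hf ((one_mul _).trans h)).symm
  have hσn : ∀ n, ∀ γ ∈ MulAction.stabilizer Γ (0 : Complex.UnitDisc),
      (σ / σ₀ ^ (stabOrder Γ * n)) γ = 1 := by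
    intro n γ hγ
    rw [character_div_pow_apply, hσ1 γ hγ, pow_mul, pow_stabOrder_apply σ₀ hγ, one_pow, div_one]
  have hgB : ∀ (f : HTwo) z, (T ^ stabOrder Γ) f z = groupBlaschke Γ z * f z :=
    pow_apply_of_forall hT' (stabOrder Γ)
  have hgle : ∀ z, ‖groupBlaschke Γ z‖ ≤ ‖(z : ℂ)‖ := fun z => by
    have h := norm_orbitBlaschke_le hconv z
    rw [groupBlaschke, norm_pow]
    exact (pow_le_of_le_one (norm_nonneg _) (h.trans z.norm_lt_one.le) hm.ne').trans h
  have hmem : ∀ n, ∀ f ∈ M (n + 1), (T ^ stabOrder Γ) f ∈ M n := fun n f hf => by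
    rw [hM] at hf
    exact pow_mem_HSigma hσ₀ hT' _ _ hf
  have hfun : ∀ n, basisFun Γ σ σ₀ n = ((T ^ stabOrder Γ) ^ n) (κ n : HTwo) := fun n =>
    funext fun z => (pow_apply_of_forall hgB n _ z).symm
  obtain ⟨b, hb⟩ := exists_hilbertBasis_of_wandering (H := HTwo) (T ^ stabOrder Γ) M hM₀
    (fun n => (κ n : HTwo)) (fun n => (κ n).2)
    (fun n => (normKernelFun_eq_zero_or (M n) 0).imp (congrArg Subtype.val) id) hmem
    (fun n f hf => by
      refine (inner_normKernelFun (M n) 0 ⟨_, hmem n f hf⟩).trans ?_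
      have h0 : groupBlaschke Γ 0 = 0 := by simpa using hgle 0
      rw [coe_submodule_apply, hgB, h0, zero_mul, mul_zero])
    (fun n f hf h => by
      obtain ⟨g, hg, hgf⟩ := exists_mem_HSigma_of_apply_zero_of_stabilizer hΓ hconv hσ₀ hT' hTr
        (hσn n) hf (apply_eq_zero_of_inner_normKernelFun (M n) (w := 0) (f := ⟨f, hf⟩) h)
      exact ⟨g, by rwa [hM], hgf⟩)
    (fun f hf => eq_zero_of_forall_exists_pow hgB hgle hf)
    (p := fun n => basisFun Γ σ σ₀ n ≠ 0) (fun n => by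
      rw [hfun, Ne, Ne, ← RKHS.coe_zero (H := HTwo), DFunLike.coe_fn_eq])
  exact ⟨b, fun n => by
    rw [hfun, ← hb]
    rfl⟩
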